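/- \textbf{Theorem.} A \emph{$\mathrm{CAT}(0)$ space} is a complete metric space $(Y,d_Y)$ such that for all $x,y\in Y$ and $t\in[0,1]$ there is $z\in Y$ with $d_Y(w,z)^2\le(1-t)d_Y(w,x)^2+t\,d_Y(w,y)^2-t(1-t)d_Y(x,y)^2$ for every $w\in Y$. There exists a metric space $(X,d_X)$ with exactly $6$ points such that: (i) For every positive integer $n$ and all points $x_1,\dots,x_n\in X$ (not necessarily distinct), $$\frac12\sum_{\substack{i,j\in\{1,\dots,n\}\\ \pi_{ij}+\pi_{ji}>0}}\frac{\pi_{ij}\pi_{ji}}{\pi_{ij}+\pi_{ji}}\,d_X(x_i,x_j)^2\;\le\;\sum_{i=1}^n\sum_{j=1}^n p_iq_j\,d_X(x_i,x_j)^2$$ for all nonnegative reals $p_1,\dots,p_n,q_1,\dots,q_n$ and all $n\times n$ matrices $(\pi_{ij})$ with nonnegative real entries such that $\sum_{k}p_k=\sum_k q_k=1$ and $\sum_{k}\pi_{ik}=p_i+q_i$ for every $i$. (ii) $X$ admits no isometric (i.e. distance-preserving) embedding into any $\mathrm{CAT}(0)$ space. More precisely, Lebedeva's perturbed octahedra have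 these properties. Write $[a,b]$ for the segment joining $a,b\in\mathbb R^3$ and $(a,b)=[a,b]\setminus\{a,b\}$. There exist six distinct points $x_1,\dots,x_6\in\mathbb R^3$ such that $(x_1,x_3)\cap(x_2,x_4)$ consists of exactly one point and $(x_5,x_6)\cap\bigl(\mathrm{conv}\{x_1,x_2,x_3,x_4\}\setminus\bigcup_{1\le i<j\le4}[x_i,x_j]\bigr)$ consists of exactly one point. For any such six points there is $C>0$, depending only on $x_1,\dots,x_6$, such that for every $\varepsilon\in(0,C]$ the function $d_\varepsilon$ on $L=\{x_1,\dots,x_6\}$ given by $d_\varepsilon(a,b)=\|a-b\|+\varepsilon$ if $\{a,b\}=\{x_5,x_6\}$ and $d_\varepsilon(a,b)=\|a-b\|$ otherwise ($\|\cdot\|$ the Euclidean norm) is a metric, and $(L,d_\varepsilon)$ satisfies (i) and (ii). -/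

import Mathlib

open scoped BigOperators

universe u

/-- A complete metric space is `CAT(0)` if for all `x, y` and `t ∈ [0,1]` there is a point `z`
with `d(w,z)² ≤ (1-t) d(w,x)² + t d(w,y)² - t(1-t) d(x,y)²` for every `w`. -/
def IsCAT0 (Y : Type u) [MetricSpace Y] : Prop :=
  CompleteSpace Y ∧
    ∀ x y : Y, ∀ t ∈ Set.Icc (0 : ℝ) 1, ∃ z : Y, ∀ w : Y,
      dist w z ^ 2 ≤ (1 - t) * dist w x ^ 2 + t * dist w y ^ 2 - t * (1 - t) * dist x y ^ 2

/-- `X` admits an isometric (distance preserving) embedding into some `CAT(0)` space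
(with underlying type in the universe `u`). -/
def EmbedsInCAT0 (X : Type) [MetricSpace X] : Prop :=
  ∃ (Y : Type u) (_ : MetricSpace Y), IsCAT0 Y ∧ ∃ f : X → Y, Isometry f

/-- The Andoni–Naor–Neiman inequalities on `n` points, in the form indexed by a matrix `π`. -/
def SatisfiesANN (X : Type) [MetricSpace X] (n : ℕ) : Prop :=
  ∀ (x : Fin n → X) (p q : Fin n → ℝ) (π : Fin n → Fin n → ℝ),
    (∀ i, 0 ≤ p i) → (∀ i, 0 ≤ q i) → (∀ i j, 0 ≤ π i j) →
    ∑ i, p i = 1 → ∑ i, q i = 1 → (∀ i, ∑ k, π i k = p i + q i) →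
    (1 / 2 : ℝ) * ∑ i, ∑ j with 0 < π i j + π j i,
        π i j * π j i / (π i j + π j i) * dist (x i) (x j) ^ 2
      ≤ ∑ i, ∑ j, p i * q j * dist (x i) (x j) ^ 2

/-- Six distinct points of Euclidean 3-space (`x 0, …, x 5` are the points `x₁, …, x₆`) such that
* the open segments `(x₁, x₃)` and `(x₂, x₄)` meet in exactly one point, and
* the open segment `(x₅, x₆)` meets `conv {x₁, x₂, x₃, x₄}` minus the union of the segments
  `[xᵢ, xⱼ]`, `1 ≤ i < j ≤ 4`, in exactly one point. -/
structure IsLebedevaOctahedron (x : Fin 6 → EuclideanSpace ℝ (Fin 3)) : Prop where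
  injective : Function.Injective x
  diagonals : (openSegment ℝ (x 0) (x 2) ∩ openSegment ℝ (x 1) (x 3)).ncard = 1
  axis :
    (openSegment ℝ (x 4) (x 5) ∩
      (convexHull ℝ {x 0, x 1, x 2, x 3} \
        {y | ∃ i j : Fin 6, i < j ∧ j < 4 ∧ y ∈ segment ℝ (x i) (x j)})).ncard = 1

/-- The perturbed Euclidean distance `d_ε (xᵢ, xⱼ)`: the distance of the fifth and the sixth point
is increased by `ε`, and all other distances are unchanged. -/
noncomputable def lebedevaDist (x : Fin 6 → EuclideanSpace ℝ (Fin 3)) (ε : ℝ) (i j : Fin 6) : ℝ :=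
  if (i = 4 ∧ j = 5) ∨ (i = 5 ∧ j = 4) then ‖x i - x j‖ + ε else ‖x i - x j‖

/-! The inequalities (i) follow from a choice of radii. If `d (x i) (x j) ≤ u i + u j`, then the
left side is at most `∑ (p i + q i) * u i ^ 2` by Cauchy–Schwarz and the row sums of `π`, so for
each pair of probability weights `P`, `Q` it suffices to make this at most `∑ P i * Q j * d ^ 2`.
For points of a Euclidean space the distances to the barycentre `z` of `(P + Q) / 2` are such radii.

For the perturbed octahedron the position of `z` decides. Off the closed axis `[x 4, x 5]`, the
strict triangle inequality at `z` leaves room for the extra `ε`, and the old radii still work. On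
the open axis, `x 5` is pushed outwards by `ε`; the axis length becomes exact, and the small errors
in the other distances are absorbed by shrinking the radii of the base points, since `z` lies on no
other edge. If `z` is close to an apex, both `P` and `Q` concentrate there, and a star centred at
that apex gives radii. Compactness of the simplex of weights makes the choice of `ε` uniform. The
cases are `eventually_hasRadii_of_notMem_axis`, `eventually_hasRadii_of_mem_axis` and
`exists_radii_of_star`.

For (ii), a `CAT(0)` space that contains the flat base quadrilateral, whose diagonals cross, also
contains a point `o'` playing the role of the point `o` where the axis meets the base. Comparison
bounds the distances from the apices to `o'` by the Euclidean ones, so the apices are at distance at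
most `‖x 4 - x 5‖`, which excludes the additional `ε`. This is `IsCAT0.dist_le_of_quadrilateral`. -/

/-! ### A sufficient condition for the Andoni–Naor–Neiman inequalities -/

/-- The pushforward of the weights `p` along `k`. -/
noncomputable def pushWeights {ι κ : Type*} [Fintype κ] [DecidableEq ι] (k : κ → ι) (p : κ → ℝ)
    (a : ι) : ℝ := ∑ i, if k i = a then p i else 0

section pushWeights

variable {ι κ : Type*} [Fintype κ] [DecidableEq ι]

lemma pushWeights_nonneg {k : κ → ι} {p : κ → ℝ} (hp : ∀ i, 0 ≤ p i) (a : ι) :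
    0 ≤ pushWeights k p a :=
  Finset.sum_nonneg fun i _ => by split_ifs <;> simp [hp]

variable [Fintype ι]

lemma sum_pushWeights_mul (k : κ → ι) (p : κ → ℝ) (g : ι → ℝ) :
    ∑ a, pushWeights k p a * g a = ∑ i, p i * g (k i) := by
  simp only [pushWeights, Finset.sum_mul]
  rw [Finset.sum_comm]
  simp

lemma sum_pushWeights (k : κ → ι) (p : κ → ℝ) : ∑ a, pushWeights k p a = ∑ i, p i := by
  simpa using sum_pushWeights_mul k p fun _ => 1

end pushWeights

lemma mul_div_add_mul_sq_le {a b u v d : ℝ} (hab : 0 < a + b) (ha : 0 ≤ a) (hb : 0 ≤ b)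
    (hd : 0 ≤ d) (hduv : d ≤ u + v) : a * b / (a + b) * d ^ 2 ≤ a * u ^ 2 + b * v ^ 2 := by
  have h1 : a * b / (a + b) * d ^ 2 ≤ a * b / (a + b) * (u + v) ^ 2 := by gcongr
  refine h1.trans ?_
  rw [div_mul_eq_mul_div, div_le_iff₀ hab]
  nlinarith [sq_nonneg (a * u - b * v)]

/-- A family of "radii" `u` that dominates the distances certifies the inequalities. -/
lemma satisfiesANN_of_radii {X ι : Type} [MetricSpace X] [Fintype ι] (e : ι ≃ X)
    (H : ∀ P ∈ stdSimplex ℝ ι, ∀ Q ∈ stdSimplex ℝ ι, ∃ u : ι → ℝ,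
      (∀ i j, dist (e i) (e j) ≤ u i + u j) ∧
      ∑ i, (P i + Q i) * u i ^ 2 ≤ ∑ i, ∑ j, P i * Q j * dist (e i) (e j) ^ 2) (n : ℕ) :
    SatisfiesANN X n := by
  classical
  intro x p q π hp hq hπ hp1 hq1 hsum
  set k : Fin n → ι := fun i => e.symm (x i) with hk
  have hxk : ∀ i, x i = e (k i) := fun i => by simp [hk]
  obtain ⟨u, hu, hle⟩ := H (pushWeights k p) ⟨pushWeights_nonneg hp, by rw [sum_pushWeights, hp1]⟩
    (pushWeights k q) ⟨pushWeights_nonneg hq, by rw [sum_pushWeights, hq1]⟩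
  have hR : ∑ i, ∑ j, pushWeights k p i * pushWeights k q j * dist (e i) (e j) ^ 2
      = ∑ i, ∑ j, p i * q j * dist (x i) (x j) ^ 2 := by
    simp only [mul_assoc, ← Finset.mul_sum]
    simp only [sum_pushWeights_mul, hxk]
  have hL : ∑ i, (pushWeights k p i + pushWeights k q i) * u i ^ 2
      = ∑ i, (p i + q i) * u (k i) ^ 2 := by
    simp only [add_mul, Finset.sum_add_distrib, sum_pushWeights_mul k _ fun i => u i ^ 2]
  rw [hR, hL] at hle
  refine le_trans ?_ hle
  have h1 : ∑ i, ∑ j with 0 < π i j + π j i,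
      π i j * π j i / (π i j + π j i) * dist (x i) (x j) ^ 2
      ≤ ∑ i, ∑ j, (π i j * u (k i) ^ 2 + π j i * u (k j) ^ 2) := by
    refine Finset.sum_le_sum fun i _ => ?_
    refine (Finset.sum_le_sum (g := fun j => π i j * u (k i) ^ 2 + π j i * u (k j) ^ 2)
      fun j hj => ?_).trans ?_
    · refine mul_div_add_mul_sq_le (Finset.mem_filter.1 hj).2 (hπ _ _) (hπ _ _) dist_nonneg ?_
      rw [hxk i, hxk j]
      exact hu _ _
    · refine Finset.sum_le_sum_of_subset_of_nonneg (Finset.filter_subset _ _) fun j _ _ => ?_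
      have := hπ i j
      have := hπ j i
      positivity
  have h2 : ∑ i, ∑ j, π i j * u (k i) ^ 2 = ∑ i, (p i + q i) * u (k i) ^ 2 := by
    simp only [← Finset.sum_mul, hsum]
  have h3 : ∑ i, ∑ j, π j i * u (k j) ^ 2 = ∑ i, (p i + q i) * u (k i) ^ 2 := by
    rw [Finset.sum_comm, h2]
  simp only [Finset.sum_add_distrib, h2, h3] at h1
  linarith

/-! ### Radii for weights concentrated near one point -/

/-- Near the vertex `a` of a finite metric space the star centred at `a` provides radii. -/
lemma exists_radii_of_star {ι : Type*} [Fintype ι] {D : ι → ι → ℝ}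
    (hsymm : ∀ i j, D i j = D j i) (hself : ∀ i, D i i = 0)
    (htri : ∀ i j k, D i k ≤ D i j + D j k) {P Q : ι → ℝ} (hP : P ∈ stdSimplex ℝ ι)
    (hQ : Q ∈ stdSimplex ℝ ι) (a : ι)
    (hs : ∀ i j, i ≠ a → j ≠ a → ∑ k, (P k + Q k) * D a k ≤ D a i + D a j - D i j) :
    ∃ u : ι → ℝ, (∀ i j, D i j ≤ u i + u j) ∧
      ∑ i, (P i + Q i) * u i ^ 2 ≤ ∑ i, ∑ j, P i * Q j * D i j ^ 2 := by
  classical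
  have hD : ∀ i j, 0 ≤ D i j := fun i j => by
    have := htri i j i
    rw [hself, hsymm j i] at this
    linarith
  set A := ∑ k, P k * D a k with hA
  set B := ∑ k, Q k * D a k with hB
  have hAB : ∑ k, (P k + Q k) * D a k = A + B := by
    simp only [add_mul, Finset.sum_add_distrib, hA, hB]
  have hA0 : 0 ≤ A := Finset.sum_nonneg fun k _ => mul_nonneg (hP.1 k) (hD _ _)
  have hB0 : 0 ≤ B := Finset.sum_nonneg fun k _ => mul_nonneg (hQ.1 k) (hD _ _)
  rw [hAB] at hs
  -- Moving the radius `s` from the leaves to the centre costs `2 * s ^ 2 - 2 * s * (A + B)` in the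
  -- weighted sum of squares; `s = (A + B) / 2` is the minimiser.
  refine ⟨fun i => if i = a then (A + B) / 2 else D a i - (A + B) / 2, fun i j => ?_, ?_⟩
  · by_cases hi : i = a <;> by_cases hj : j = a
    · subst hi
      subst hj
      simp [hself]
      linarith
    · subst hi
      simp [hj]
    · subst hj
      simp [hi, hsymm i j]
    · have := hs i j hi hj
      simp [hi, hj]
      linarith
  · have hu : ∀ i, (if i = a then (A + B) / 2 else D a i - (A + B) / 2) ^ 2
        = D a i ^ 2 - (A + B) * D a i + (A + B) ^ 2 / 4 := fun i => by
      split_ifs with h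
      · subst h
        rw [hself]
        ring
      · ring
    set A2 := ∑ k, P k * D a k ^ 2 with hA2
    set B2 := ∑ k, Q k * D a k ^ 2 with hB2
    have hL : ∑ i, (P i + Q i) * (if i = a then (A + B) / 2 else D a i - (A + B) / 2) ^ 2
        = A2 + B2 - (A + B) ^ 2 / 2 := by
      simp only [hu]
      have : ∀ i, (P i + Q i) * (D a i ^ 2 - (A + B) * D a i + (A + B) ^ 2 / 4)
          = P i * D a i ^ 2 + Q i * D a i ^ 2 - (A + B) * (P i * D a i + Q i * D a i)
            + (A + B) ^ 2 / 4 * (P i + Q i) := fun i => by ring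
      simp only [this, Finset.sum_add_distrib, Finset.sum_sub_distrib, ← Finset.mul_sum, hP.2, hQ.2]
      simp only [← hA, ← hB, ← hA2, ← hB2]
      ring
    -- The reverse triangle inequality replaces `D i j` by `|D a i - D a j|`, after which the double
    -- sum factors.
    have hR : A2 + B2 - 2 * (A * B) ≤ ∑ i, ∑ j, P i * Q j * D i j ^ 2 := by
      have h1 : ∑ i, ∑ j, P i * Q j * (D a i ^ 2 + D a j ^ 2 - 2 * (D a i * D a j))
          = A2 + B2 - 2 * (A * B) := by
        have : ∀ i j, P i * Q j * (D a i ^ 2 + D a j ^ 2 - 2 * (D a i * D a j))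
          = (P i * D a i ^ 2) * Q j + P i * (Q j * D a j ^ 2)
            - 2 * ((P i * D a i) * (Q j * D a j)) := fun i j => by ring
        simp only [this, Finset.sum_add_distrib, Finset.sum_sub_distrib, ← Finset.mul_sum,
          ← Finset.sum_mul, hP.2, hQ.2]
        simp only [← hA, ← hB, ← hA2, ← hB2]
        ring
      rw [← h1]
      refine Finset.sum_le_sum fun i _ => Finset.sum_le_sum fun j _ => ?_
      refine mul_le_mul_of_nonneg_left ?_ (mul_nonneg (hP.1 i) (hQ.1 j))
      have e1 := htri a i j
      have e2 := htri a j i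
      rw [hsymm j i] at e2
      have : (D a i - D a j) ^ 2 ≤ D i j ^ 2 := sq_le_sq' (by linarith) (by linarith)
      linarith
    rw [hL]
    nlinarith [sq_nonneg (A - B)]

/-! ### Radii from an approximate realisation in a Euclidean space -/

section Euclidean

variable {ι E : Type*} [Fintype ι] [NormedAddCommGroup E] [InnerProductSpace ℝ E]

-- The barycentres of `P` and of `Q` are symmetric about the midpoint `z`. Expanding around `z`, the
-- cross term is the inner product of two opposite vectors, hence nonpositive.
open scoped RealInnerProductSpace in
lemma sum_mul_norm_sub_midpoint_sq_le (y : ι → E) {P Q R : ι → ℝ} (hP : P ∈ stdSimplex ℝ ι)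
    (hQ : Q ∈ stdSimplex ℝ ι) (hR : ∀ i, R i = (P i + Q i) / 2) :
    ∑ i, (P i + Q i) * ‖y i - ∑ k, R k • y k‖ ^ 2 ≤ ∑ i, ∑ j, P i * Q j * ‖y i - y j‖ ^ 2 := by
  set z := ∑ k, R k • y k with hz
  set v := ∑ i, P i • (y i - z) with hv
  set w := ∑ i, Q i • (y i - z) with hw
  have hvw : v + w = 0 := by
    have h1 : v = ∑ i, P i • y i - z := by
      simp only [hv, smul_sub, Finset.sum_sub_distrib, ← Finset.sum_smul, hP.2, one_smul]
    have h2 : w = ∑ i, Q i • y i - z := by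
      simp only [hw, smul_sub, Finset.sum_sub_distrib, ← Finset.sum_smul, hQ.2, one_smul]
    have h3 : (2 : ℝ) • z = ∑ i, P i • y i + ∑ i, Q i • y i := by
      rw [hz, Finset.smul_sum, ← Finset.sum_add_distrib]
      refine Finset.sum_congr rfl fun i _ => ?_
      rw [hR, ← add_smul, smul_smul]
      congr 1
      ring
    rw [h1, h2]
    have : ∑ i, P i • y i - z + (∑ i, Q i • y i - z)
        = (∑ i, P i • y i + ∑ i, Q i • y i) - (2 : ℝ) • z := by module
    rw [this, h3, sub_self]
  have hinner : ∑ i, ∑ j, P i * Q j * ⟪y i - z, y j - z⟫ = ⟪v, w⟫ := by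
    rw [hv, hw, sum_inner]
    refine Finset.sum_congr rfl fun i _ => ?_
    rw [inner_sum]
    refine Finset.sum_congr rfl fun j _ => ?_
    rw [real_inner_smul_left, real_inner_smul_right]
    ring
  have hw' : w = -v := (neg_eq_of_add_eq_zero_right hvw).symm
  have hneg : ⟪v, w⟫ ≤ 0 := by
    rw [hw', inner_neg_right]
    linarith [real_inner_self_nonneg (x := v)]
  have key : ∑ i, ∑ j, P i * Q j * ‖y i - y j‖ ^ 2
      = ∑ i, (P i + Q i) * ‖y i - z‖ ^ 2 - 2 * ⟪v, w⟫ := by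
    have h1 : ∀ i j, P i * Q j * ‖y i - y j‖ ^ 2 = (P i * ‖y i - z‖ ^ 2) * Q j
        + P i * (Q j * ‖y j - z‖ ^ 2) - 2 * (P i * Q j * ⟪y i - z, y j - z⟫) := fun i j => by
      have : y i - y j = (y i - z) - (y j - z) := by abel
      rw [this, norm_sub_sq_real]
      ring
    simp only [h1, Finset.sum_add_distrib, Finset.sum_sub_distrib, ← Finset.mul_sum,
      ← Finset.sum_mul, hP.2, hQ.2, hinner, add_mul]
    ring
  rw [key]
  linarith

/-- The error terms cancel: `P` and `Q` have mass one, so the allowance `c i + c j` in the squared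
distances contributes `∑ (P i + Q i) * c i`, which is what the radii give up. -/
lemma sum_radii_sq_le_of_approx {D : ι → ι → ℝ} {P Q R : ι → ℝ} (hP : P ∈ stdSimplex ℝ ι)
    (hQ : Q ∈ stdSimplex ℝ ι) (hR : ∀ i, R i = (P i + Q i) / 2) {y : ι → E} {c u : ι → ℝ}
    (hy : ∀ i j, ‖y i - y j‖ ^ 2 ≤ D i j ^ 2 + c i + c j)
    (hu : ∀ i, u i ^ 2 + c i ≤ ‖y i - ∑ k, R k • y k‖ ^ 2) :
    ∑ i, (P i + Q i) * u i ^ 2 ≤ ∑ i, ∑ j, P i * Q j * D i j ^ 2 := by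
  have h0 := sum_mul_norm_sub_midpoint_sq_le y hP hQ hR
  have h1 : ∑ i, (P i + Q i) * (u i ^ 2 + c i)
      ≤ ∑ i, (P i + Q i) * ‖y i - ∑ k, R k • y k‖ ^ 2 :=
    Finset.sum_le_sum fun i _ => mul_le_mul_of_nonneg_left (hu i) (add_nonneg (hP.1 i) (hQ.1 i))
  have h2 : ∑ i, ∑ j, P i * Q j * ‖y i - y j‖ ^ 2
      ≤ ∑ i, ∑ j, P i * Q j * (D i j ^ 2 + c i + c j) :=
    Finset.sum_le_sum fun i _ => Finset.sum_le_sum fun j _ =>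
      mul_le_mul_of_nonneg_left (hy i j) (mul_nonneg (hP.1 i) (hQ.1 j))
  have h3 : ∑ i, ∑ j, P i * Q j * (D i j ^ 2 + c i + c j)
      = ∑ i, ∑ j, P i * Q j * D i j ^ 2 + ∑ i, (P i + Q i) * c i := by
    have : ∀ i j, P i * Q j * (D i j ^ 2 + c i + c j)
        = P i * Q j * D i j ^ 2 + P i * c i * Q j + P i * (Q j * c j) := fun i j => by ring
    simp only [this, Finset.sum_add_distrib, ← Finset.mul_sum, ← Finset.sum_mul, hP.2, hQ.2,
      add_mul]
    ring
  simp only [mul_add, Finset.sum_add_distrib] at h1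
  linarith

lemma norm_lt_norm_sub_add_norm_sub {a b z : E} (hz : z ∉ segment ℝ a b) :
    ‖a - b‖ < ‖a - z‖ + ‖b - z‖ := by
  rw [mem_segment_iff_wbtw, ← dist_add_dist_eq_iff, dist_comm z b] at hz
  simp only [← dist_eq_norm]
  refine lt_of_le_of_ne ?_ (Ne.symm hz)
  rw [dist_comm b z]
  exact dist_triangle _ _ _

lemma norm_sub_combo_sq (w a b : E) (t : ℝ) : ‖w - ((1 - t) • a + t • b)‖ ^ 2
    = (1 - t) * ‖w - a‖ ^ 2 + t * ‖w - b‖ ^ 2 - t * (1 - t) * ‖a - b‖ ^ 2 := by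
  have h1 : w - ((1 - t) • a + t • b) = (1 - t) • (w - a) + t • (w - b) := by module
  have h2 : a - b = (w - b) - (w - a) := by abel
  rw [h1, h2, norm_add_sq_real, norm_sub_sq_real (w - b), norm_smul, norm_smul, real_inner_smul_left,
    real_inner_smul_right, mul_pow, mul_pow, Real.norm_eq_abs, Real.norm_eq_abs, sq_abs, sq_abs,
    real_inner_comm (w - a) (w - b)]
  ring

end Euclidean
/-! ### Geometry of the octahedra -/

section Plane

variable {E : Type*} [AddCommGroup E] [Module ℝ E]

lemma exists_weights_of_mem_convexHull {a b c d o : E} (ho : o ∈ convexHull ℝ {a, b, c, d}) :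
    ∃ p q r s : ℝ, 0 ≤ p ∧ 0 ≤ q ∧ 0 ≤ r ∧ 0 ≤ s ∧ p + q + r + s = 1 ∧
      o = p • a + q • b + r • c + s • d := by
  rw [convexHull_insert (by simp), convexHull_insert (by simp), convexHull_pair] at ho
  simp only [mem_convexJoin, Set.mem_singleton_iff, exists_eq_left] at ho
  obtain ⟨y, ⟨z, ⟨t₁, t₂, ht₁, ht₂, ht, rfl⟩, ⟨u₁, u₂, hu₁, hu₂, hu, rfl⟩⟩,
    ⟨v₁, v₂, hv₁, hv₂, hv, rfl⟩⟩ := ho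
  refine ⟨v₁, v₂ * u₁, v₂ * (u₂ * t₁), v₂ * (u₂ * t₂), hv₁, by positivity, by positivity,
    by positivity, ?_, by module⟩
  calc v₁ + v₂ * u₁ + v₂ * (u₂ * t₁) + v₂ * (u₂ * t₂)
      = v₁ + v₂ * (u₁ + u₂ * (t₁ + t₂)) := by ring
    _ = 1 := by rw [ht, mul_one, hu, mul_one, hv]

/-- A nonnegative combination of two opposite vectors is a nonnegative multiple of one of them. -/
lemma exists_smul_of_opposite {v w : E} {s p q : ℝ} (hs : s ∈ Set.Ioo (0 : ℝ) 1)
    (h : (1 - s) • v + s • w = 0) (hp : 0 ≤ p) (hq : 0 ≤ q) :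
    (∃ A, 0 ≤ A ∧ A ≤ p ∧ p • v + q • w = A • v) ∨
      ∃ A, 0 ≤ A ∧ A ≤ q ∧ p • v + q • w = A • w := by
  obtain ⟨h0, h1⟩ := hs
  rcases le_total (q * (1 - s)) (p * s) with hle | hle
  · left
    refine ⟨p - q * (1 - s) / s, ?_, ?_, ?_⟩
    · rw [sub_nonneg, div_le_iff₀ h0]
      exact hle
    · have : 0 ≤ q * (1 - s) / s := by
        have : 0 ≤ 1 - s := by linarith
        positivity
      linarith
    · have : w = -((1 - s) / s) • v := by
        have h2 : s • w = -((1 - s) • v) := by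
          rw [eq_neg_iff_add_eq_zero, add_comm, h]
        calc w = s⁻¹ • (s • w) := by rw [smul_smul, inv_mul_cancel₀ h0.ne', one_smul]
          _ = _ := by rw [h2, smul_neg, smul_smul, neg_smul, div_eq_inv_mul]
      rw [this]
      module
  · right
    have h1' : 0 < 1 - s := by linarith
    refine ⟨q - p * s / (1 - s), ?_, ?_, ?_⟩
    · rw [sub_nonneg, div_le_iff₀ h1']
      exact hle
    · have : 0 ≤ p * s / (1 - s) := by positivity
      linarith
    · have : v = -(s / (1 - s)) • w := by
        have h2 : (1 - s) • v = -(s • w) := by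
          rw [eq_neg_iff_add_eq_zero, h]
        calc v = (1 - s)⁻¹ • ((1 - s) • v) := by rw [smul_smul, inv_mul_cancel₀ h1'.ne', one_smul]
          _ = _ := by rw [h2, smul_neg, smul_smul, neg_smul, div_eq_inv_mul]
      rw [this]
      module

/-- A point of the hull of a quadrilateral whose diagonals meet in `m` lies in one of the four
triangles cut out by the diagonals. -/
lemma exists_triangle_of_mem_convexHull {x : Fin 6 → E} {m o : E} {s t : ℝ}
    (hs : s ∈ Set.Ioo (0 : ℝ) 1) (ht : t ∈ Set.Ioo (0 : ℝ) 1)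
    (hm₁ : m = (1 - s) • x 0 + s • x 2) (hm₂ : m = (1 - t) • x 1 + t • x 3)
    (ho : o ∈ convexHull ℝ {x 0, x 1, x 2, x 3}) :
    ∃ i i' j j' : Fin 6, ((i = 0 ∧ i' = 2) ∨ (i = 2 ∧ i' = 0)) ∧
      ((j = 1 ∧ j' = 3) ∨ (j = 3 ∧ j' = 1)) ∧ ∃ A B : ℝ, 0 ≤ A ∧ 0 ≤ B ∧ A + B ≤ 1 ∧
        o = m + A • (x i - m) + B • (x j - m) := by
  obtain ⟨p, q, r, w, hp, hq, hr, hw, hsum, rfl⟩ := exists_weights_of_mem_convexHull ho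
  have h₁ : (1 - s) • (x 0 - m) + s • (x 2 - m) = 0 := by
    rw [← sub_eq_zero.2 hm₁.symm]
    module
  have h₂ : (1 - t) • (x 1 - m) + t • (x 3 - m) = 0 := by
    rw [← sub_eq_zero.2 hm₂.symm]
    module
  have hdec : p • x 0 + q • x 1 + r • x 2 + w • x 3
      = m + (p • (x 0 - m) + r • (x 2 - m)) + (q • (x 1 - m) + w • (x 3 - m)) := by
    have : m = (p + q + r + w) • m := by rw [hsum, one_smul]
    nth_rw 1 [this]
    module
  rw [hdec]
  rcases exists_smul_of_opposite hs h₁ hp hr with ⟨A, hA0, hA, eA⟩ | ⟨A, hA0, hA, eA⟩ <;>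
  rcases exists_smul_of_opposite ht h₂ hq hw with ⟨B, hB0, hB, eB⟩ | ⟨B, hB0, hB, eB⟩
  · exact ⟨0, 2, 1, 3, by simp, by simp, A, B, hA0, hB0, by linarith, by rw [eA, eB]⟩
  · exact ⟨0, 2, 3, 1, by simp, by simp, A, B, hA0, hB0, by linarith, by rw [eA, eB]⟩
  · exact ⟨2, 0, 1, 3, by simp, by simp, A, B, hA0, hB0, by linarith, by rw [eA, eB]⟩
  · exact ⟨2, 0, 3, 1, by simp, by simp, A, B, hA0, hB0, by linarith, by rw [eA, eB]⟩

end Plane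

namespace IsLebedevaOctahedron

variable {x : Fin 6 → EuclideanSpace ℝ (Fin 3)}

/-- The union of the segments that join the four base points. -/
def baseSegments (x : Fin 6 → EuclideanSpace ℝ (Fin 3)) : Set (EuclideanSpace ℝ (Fin 3)) :=
  {y | ∃ i j : Fin 6, i < j ∧ j < 4 ∧ y ∈ segment ℝ (x i) (x j)}

lemma isClosed_baseSegments : IsClosed (baseSegments x) := by
  have : baseSegments x
      = ⋃ i : Fin 6, ⋃ j : Fin 6, ⋃ _ : i < j ∧ j < 4, segment ℝ (x i) (x j) := by
    ext y
    simp [baseSegments, and_assoc]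
  rw [this]
  refine isClosed_iUnion_of_finite fun i => isClosed_iUnion_of_finite fun j =>
    isClosed_iUnion_of_finite fun _ => ?_
  rw [← convexHull_pair]
  exact (Set.toFinite {x i, x j}).isClosed_convexHull ℝ

lemma segment_subset_baseSegments {i j : Fin 6} (hi : i < 4) (hj : j < 4) :
    segment ℝ (x i) (x j) ⊆ baseSegments x := by
  intro y hy
  rcases lt_trichotomy i j with h | h | h
  · exact ⟨i, j, h, hj, hy⟩
  · subst h
    rw [segment_same] at hy
    obtain rfl : y = x i := hy
    by_cases h0 : i = 0
    · subst h0
      exact ⟨0, 1, by decide, by decide, left_mem_segment _ _ _⟩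
    · exact ⟨0, i, by omega, hi, right_mem_segment _ _ _⟩
  · exact ⟨j, i, h, hi, by rwa [segment_symm]⟩

/-- The crossing point `m` of the diagonals and the point `o` where the axis meets the base, with
`o` in the interior of the triangle `m, x i, x j`. -/
lemma exists_crossing (hx : IsLebedevaOctahedron x) :
    ∃ i i' j j' : Fin 6, i < 4 ∧ i' < 4 ∧ j < 4 ∧ j' < 4 ∧
      ({i, i', j, j'} : Set (Fin 6)) = {0, 1, 2, 3} ∧
      ∃ s t A B σ : ℝ, s ∈ Set.Ioo (0 : ℝ) 1 ∧ t ∈ Set.Ioo (0 : ℝ) 1 ∧ σ ∈ Set.Ioo (0 : ℝ) 1 ∧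
      0 < A ∧ 0 < B ∧ A + B < 1 ∧ ∃ m o : EuclideanSpace ℝ (Fin 3),
        m = (1 - s) • x i + s • x i' ∧ m = (1 - t) • x j + t • x j' ∧
        o = m + A • (x i - m) + B • (x j - m) ∧ o = (1 - σ) • x 4 + σ • x 5 ∧
        openSegment ℝ (x 4) (x 5) ∩ (convexHull ℝ {x 0, x 1, x 2, x 3} \ baseSegments x) = {o} := by
  obtain ⟨m, hm⟩ := Set.ncard_eq_one.1 hx.diagonals
  have hm' : m ∈ openSegment ℝ (x 0) (x 2) ∩ openSegment ℝ (x 1) (x 3) := by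
    rw [hm]
    rfl
  obtain ⟨o, ho⟩ := Set.ncard_eq_one.1 hx.axis
  have ho' : o ∈ openSegment ℝ (x 4) (x 5) ∩
      (convexHull ℝ {x 0, x 1, x 2, x 3} \ baseSegments x) := by
    rw [baseSegments, ho]
    rfl
  obtain ⟨ho1, ho2, ho3⟩ := ho'
  rw [openSegment_eq_image, openSegment_eq_image] at hm'
  rw [openSegment_eq_image] at ho1
  obtain ⟨⟨s, hs, hms⟩, ⟨t, ht, hmt⟩⟩ := hm'
  obtain ⟨σ, hσ, hoσ⟩ := ho1
  obtain ⟨i, i', j, j', hi, hj, A, B, hA, hB, hAB, hoAB⟩ :=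
    exists_triangle_of_mem_convexHull hs ht hms.symm hmt.symm ho2
  have hi4 : i < 4 ∧ i' < 4 := by rcases hi with ⟨rfl, rfl⟩ | ⟨rfl, rfl⟩ <;> decide
  have hj4 : j < 4 ∧ j' < 4 := by rcases hj with ⟨rfl, rfl⟩ | ⟨rfl, rfl⟩ <;> decide
  have hset : ({i, i', j, j'} : Set (Fin 6)) = {0, 1, 2, 3} := by
    rcases hi with ⟨rfl, rfl⟩ | ⟨rfl, rfl⟩ <;> rcases hj with ⟨rfl, rfl⟩ | ⟨rfl, rfl⟩ <;>
      (ext k; fin_cases k <;> simp)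
  have hmi : ∃ s ∈ Set.Ioo (0 : ℝ) 1, m = (1 - s) • x i + s • x i' := by
    rcases hi with ⟨rfl, rfl⟩ | ⟨rfl, rfl⟩
    · exact ⟨s, hs, hms.symm⟩
    · exact ⟨1 - s, ⟨by linarith [hs.2], by linarith [hs.1]⟩, by rw [← hms]; module⟩
  have hmj : ∃ t ∈ Set.Ioo (0 : ℝ) 1, m = (1 - t) • x j + t • x j' := by
    rcases hj with ⟨rfl, rfl⟩ | ⟨rfl, rfl⟩
    · exact ⟨t, ht, hmt.symm⟩
    · exact ⟨1 - t, ⟨by linarith [ht.2], by linarith [ht.1]⟩, by rw [← hmt]; module⟩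
  obtain ⟨s', hs', hms'⟩ := hmi
  obtain ⟨t', ht', hmt'⟩ := hmj
  -- A vanishing coefficient would put `o` on a diagonal, and `A + B = 1` would put it on a side;
  -- `o` avoids both.
  have hA0 : A ≠ 0 := by
    rintro rfl
    refine ho3 (segment_subset_baseSegments hj4.1 hj4.2 ?_)
    rw [hoAB, segment_eq_image]
    refine ⟨(1 - B) * t', ⟨?_, ?_⟩, ?_⟩
    · exact mul_nonneg (by linarith) ht'.1.le
    · nlinarith [ht'.1, ht'.2]
    · simp only [hmt']
      module
  have hB0 : B ≠ 0 := by
    rintro rfl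
    refine ho3 (segment_subset_baseSegments hi4.1 hi4.2 ?_)
    rw [hoAB, segment_eq_image]
    refine ⟨(1 - A) * s', ⟨?_, ?_⟩, ?_⟩
    · exact mul_nonneg (by linarith) hs'.1.le
    · nlinarith [hs'.1, hs'.2]
    · simp only [hms']
      module
  have hAB1 : A + B ≠ 1 := by
    intro h
    refine ho3 (segment_subset_baseSegments hi4.1 hj4.1 ?_)
    obtain rfl : A = 1 - B := by linarith
    rw [hoAB, segment_eq_image]
    exact ⟨B, ⟨hB, by linarith⟩, by module⟩
  exact ⟨i, i', j, j', hi4.1, hi4.2, hj4.1, hj4.2, hset, s', t', A, B, σ, hs', ht', hσ,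
    hA.lt_of_ne' hA0, hB.lt_of_ne' hB0, hAB.lt_of_ne hAB1, m, o, hms', hmt', hoAB, hoσ.symm, ho⟩

/-- The two apices lie strictly on different sides of the base plane. -/
lemma exists_height (hx : IsLebedevaOctahedron x) :
    ∃ (f : EuclideanSpace ℝ (Fin 3) →ₗ[ℝ] ℝ) (c σ : ℝ), σ ∈ Set.Ioo (0 : ℝ) 1 ∧
      (∀ k : Fin 6, k < 4 → f (x k) = c) ∧ f (x 4) = c - σ ∧ f (x 5) = c + (1 - σ) ∧
      (1 - σ) • x 4 + σ • x 5 ∉ baseSegments x := by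
  obtain ⟨i, i', j, j', hi, hi', hj, hj', hset, s, t, A, B, σ, hs, ht, hσ, hA, hB, hAB, m, o, hms,
    hmt, ho, hoσ, haxis⟩ := hx.exists_crossing
  have hmem : o ∈ openSegment ℝ (x 4) (x 5) ∩
      (convexHull ℝ {x 0, x 1, x 2, x 3} \ baseSegments x) := by
    rw [haxis]
    rfl
  have hhull : ∀ k : Fin 6, k ∈ ({i, i', j, j'} : Set (Fin 6)) →
      x k ∈ convexHull ℝ {x 0, x 1, x 2, x 3} := by
    intro k hk
    rw [hset] at hk
    refine subset_convexHull ℝ _ ?_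
    simp only [Set.mem_insert_iff, Set.mem_singleton_iff] at hk
    rcases hk with rfl | rfl | rfl | rfl <;> simp
  have hconv := convex_convexHull ℝ {x 0, x 1, x 2, x 3}
  have hmhull : m ∈ convexHull ℝ {x 0, x 1, x 2, x 3} := by
    rw [hms]
    exact hconv (hhull i (by simp)) (hhull i' (by simp)) (by linarith [hs.2]) hs.1.le (by ring)
  -- Were the axis parallel to the base plane, `o` could slide along it a little while staying
  -- inside the triangle `m, x i, x j` and off the closed set of base segments, contradicting
  -- uniqueness of the intersection point.
  have hplane : x 5 - x 4 ∉ Submodule.span ℝ {x i - m, x j - m} := by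
    intro hspan
    obtain ⟨α, β, hαβ⟩ := Submodule.mem_span_pair.1 hspan
    have htend : Filter.Tendsto (fun τ : ℝ => o + τ • (x 5 - x 4)) (nhds 0) (nhds o) := by
      have : Continuous fun τ : ℝ => o + τ • (x 5 - x 4) := by fun_prop
      simpa using this.tendsto 0
    have e1 : ∀ᶠ τ : ℝ in nhds 0, o + τ • (x 5 - x 4) ∉ baseSegments x :=
      htend.eventually (isClosed_baseSegments.isOpen_compl.mem_nhds hmem.2.2)
    have aux : ∀ g : ℝ → ℝ, Continuous g → 0 < g 0 → ∀ᶠ τ : ℝ in nhds 0, 0 < g τ :=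
      fun g hg h0 => hg.continuousAt.eventually (lt_mem_nhds h0)
    have e2 := aux (fun τ => σ + τ) (by fun_prop) (by simpa using hσ.1)
    have e3 := aux (fun τ => 1 - (σ + τ)) (by fun_prop) (by simpa using hσ.2)
    have e4 := aux (fun τ => A + τ * α) (by fun_prop) (by simpa using hA)
    have e5 := aux (fun τ => B + τ * β) (by fun_prop) (by simpa using hB)
    have e6 := aux (fun τ => 1 - (A + τ * α) - (B + τ * β)) (by fun_prop) (by simp; linarith)
    have e : ∀ᶠ τ : ℝ in nhds 0, o + τ • (x 5 - x 4) = o := by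
      filter_upwards [e1, e2, e3, e4, e5, e6] with τ h1 h2 h3 h4 h5 h6
      have : o + τ • (x 5 - x 4) ∈ openSegment ℝ (x 4) (x 5) ∩
          (convexHull ℝ {x 0, x 1, x 2, x 3} \ baseSegments x) := by
        refine ⟨?_, ?_, h1⟩
        · refine ⟨1 - (σ + τ), σ + τ, h3, h2, by ring, ?_⟩
          rw [hoσ]
          module
        · have : o + τ • (x 5 - x 4) = (1 - (A + τ * α) - (B + τ * β)) • m
              + (A + τ * α) • x i + (B + τ * β) • x j := by
            rw [ho, ← hαβ]
            module
          rw [this]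
          have h := hconv.sum_mem (t := Finset.univ)
            (w := ![1 - (A + τ * α) - (B + τ * β), A + τ * α, B + τ * β]) (z := ![m, x i, x j])
            (by intro k _; fin_cases k <;> simp [h4.le, h5.le]; linarith)
            (by simp [Fin.sum_univ_three]; ring)
            (by
              intro k _
              fin_cases k
              exacts [hmhull, hhull i (by simp), hhull j (by simp)])
          simpa [Fin.sum_univ_three] using h
      rw [haxis] at this
      exact this
    obtain ⟨τ, hτ, hτ0⟩ := ((e.filter_mono nhdsWithin_le_nhds).and
      (self_mem_nhdsWithin : {(0 : ℝ)}ᶜ ∈ nhdsWithin (0 : ℝ) {0}ᶜ)).exists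
    have : τ • (x 5 - x 4) = 0 := by simpa using hτ
    rcases smul_eq_zero.1 this with h | h
    · exact hτ0 h
    · exact absurd (hx.injective (sub_eq_zero.1 h)) (by decide)
  obtain ⟨f, hf, hker⟩ := Submodule.exists_le_ker_of_notMem hplane
  have hfi : f (x i) = f m := by
    have := hker (Submodule.subset_span (by simp : x i - m ∈ ({x i - m, x j - m} : Set _)))
    rwa [LinearMap.mem_ker, map_sub, sub_eq_zero] at this
  have hfj : f (x j) = f m := by
    have := hker (Submodule.subset_span (by simp : x j - m ∈ ({x i - m, x j - m} : Set _)))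
    rwa [LinearMap.mem_ker, map_sub, sub_eq_zero] at this
  have hother : ∀ {k k' : Fin 6} {r : ℝ}, r ∈ Set.Ioo (0 : ℝ) 1 →
      m = (1 - r) • x k + r • x k' → f (x k) = f m → f (x k') = f m := by
    intro k k' r hr h hk
    have h' := congrArg f h
    simp only [map_add, map_smul, smul_eq_mul, hk] at h'
    refine mul_left_cancel₀ hr.1.ne' ?_
    linarith
  have hall : ∀ k : Fin 6, k < 4 → f (x k) = f m := by
    intro k hk
    have hk' : k ∈ ({i, i', j, j'} : Set (Fin 6)) := by
      rw [hset]
      simp only [Set.mem_insert_iff, Set.mem_singleton_iff]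
      omega
    simp only [Set.mem_insert_iff, Set.mem_singleton_iff] at hk'
    rcases hk' with rfl | rfl | rfl | rfl
    exacts [hfi, hother hs hms hfi, hfj, hother ht hmt hfj]
  have hfo : f o = f m := by
    rw [ho]
    simp [hfi, hfj]
  set κ := f (x 5 - x 4) with hκ
  have h45 : f (x 5) = f (x 4) + κ := by rw [hκ, map_sub]; ring
  have h4 : f (x 4) = f m - σ * κ := by
    have h := congrArg f hoσ
    simp only [map_add, map_smul, smul_eq_mul, hfo, h45] at h
    linarith
  -- Rescaled so that the height rises by exactly one from `x 4` to `x 5`.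
  refine ⟨κ⁻¹ • f, κ⁻¹ * f m, σ, hσ, fun k hk => ?_, ?_, ?_, ?_⟩
  · simp [hall k hk]
  · simp only [LinearMap.smul_apply, smul_eq_mul, h4]
    field_simp
  · simp only [LinearMap.smul_apply, smul_eq_mul, h45, h4]
    field_simp
    ring
  · rw [← hoσ]
    exact hmem.2.2

/-- A point of the open axis lies on no other segment between the vertices. -/
lemma notMem_segment_of_mem_axis (hx : IsLebedevaOctahedron x) {z : EuclideanSpace ℝ (Fin 3)}
    (hz : z ∈ openSegment ℝ (x 4) (x 5)) {i j : Fin 6} (h45 : ¬(i = 4 ∧ j = 5))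
    (h54 : ¬(i = 5 ∧ j = 4)) : z ∉ segment ℝ (x i) (x j) := by
  obtain ⟨f, c, σ, hσ, hf, hf4, hf5, ho⟩ := hx.exists_height
  rw [openSegment_eq_image] at hz
  obtain ⟨θ, hθ, rfl⟩ := hz
  have hfz : f ((1 - θ) • x 4 + θ • x 5) = c + (θ - σ) := by
    simp only [map_add, map_smul, smul_eq_mul, hf4, hf5]
    ring
  have hθ0 := hθ.1
  have hθ1 := hθ.2
  have hne : x 4 ≠ x 5 := hx.injective.ne (by decide)
  have h4 : (1 - θ) • x 4 + θ • x 5 ≠ x 4 := fun h => by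
    have h' : f ((1 - θ) • x 4 + θ • x 5) = f (x 4) := congrArg f h
    rw [hfz, hf4] at h'
    linarith
  have h5 : (1 - θ) • x 4 + θ • x 5 ≠ x 5 := fun h => by
    have h' : f ((1 - θ) • x 4 + θ • x 5) = f (x 5) := congrArg f h
    rw [hfz, hf5] at h'
    linarith
  have hbase : ∀ k : Fin 6, k < 4 → ∀ r : ℝ, (1 - r) • x 4 + r • x 5 ≠ x k := by
    intro k hk r h
    have h' := congrArg f h
    simp only [map_add, map_smul, smul_eq_mul, hf4, hf5, hf k hk] at h'
    have hr : r = σ := by linarith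
    rw [hr] at h
    rw [h] at ho
    exact ho (segment_subset_baseSegments hk hk (left_mem_segment _ _ _))
  have hmixed : ∀ a k : Fin 6, k < 4 → a = 4 ∨ a = 5 →
      (1 - θ) • x 4 + θ • x 5 ∉ segment ℝ (x a) (x k) := by
    intro a k hk ha hz
    rw [segment_eq_image] at hz
    obtain ⟨t, ⟨ht0, ht1⟩, ht⟩ := hz
    simp only at ht
    rcases ht0.eq_or_lt with rfl | htpos
    · simp only [sub_zero, one_smul, zero_smul, add_zero] at ht
      rcases ha with rfl | rfl
      · exact h4 ht.symm
      · exact h5 ht.symm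
    -- Here `x k` lies on the line of the axis, and by its height it would be `o`, which is not a
    -- vertex.
    · have hk' : x k = t⁻¹ • ((1 - θ) • x 4 + θ • x 5 - (1 - t) • x a) := by
        rw [← ht, add_sub_cancel_left, smul_smul, inv_mul_cancel₀ htpos.ne', one_smul]
      rcases ha with rfl | rfl
      · refine hbase k hk (t⁻¹ * θ) ?_
        rw [hk']
        match_scalars
        · field_simp
          ring
        · ring
      · refine hbase k hk (1 - t⁻¹ * (1 - θ)) ?_
        rw [hk']
        match_scalars
        · ring
        · field_simp
          ring
  by_cases hi : i < 4 <;> by_cases hj : j < 4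
  · intro hz
    obtain ⟨a, b, ha, hb, hab, h⟩ := hz
    have h' := congrArg f h
    rw [hfz] at h'
    simp only [map_add, map_smul, smul_eq_mul, hf i hi, hf j hj, ← add_mul, hab] at h'
    have hr : θ = σ := by linarith
    rw [hr] at h
    exact ho (segment_subset_baseSegments hi hj ⟨a, b, ha, hb, hab, h⟩)
  · rw [segment_symm]
    exact hmixed j i hi (by omega)
  · exact hmixed i j hj (by omega)
  · obtain rfl : i = j := by omega
    rw [segment_same]
    have : i = 4 ∨ i = 5 := by omega
    rcases this with rfl | rfl
    exacts [h4, h5]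

/-- The apices are extreme points of the octahedron. -/
lemma eq_one_of_sum_smul_eq (hx : IsLebedevaOctahedron x) {R : Fin 6 → ℝ}
    (hR : R ∈ stdSimplex ℝ (Fin 6)) {a : Fin 6} (ha : a = 4 ∨ a = 5)
    (h : ∑ k, R k • x k = x a) : 1 ≤ R a := by
  obtain ⟨f, c, σ, ⟨hσ0, hσ1⟩, hf, hf4, hf5, -⟩ := hx.exists_height
  have h1 := hR.2
  rw [Fin.sum_univ_six] at h h1
  have h' := congrArg f h
  have p4 := hR.1 4
  have p5 := hR.1 5
  simp only [map_add, map_smul, smul_eq_mul, hf4, hf5, hf 0 (by decide), hf 1 (by decide),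
    hf 2 (by decide), hf 3 (by decide)] at h'
  have e : c * (R 0 + R 1 + R 2 + R 3 + R 4 + R 5) - σ * R 4 + (1 - σ) * R 5 = f (x a) := by
    linarith
  rw [h1, mul_one] at e
  rcases ha with rfl | rfl
  · rw [hf4] at e
    nlinarith
  · rw [hf5] at e
    nlinarith

lemma apex_notMem_segment (hx : IsLebedevaOctahedron x) {a i j : Fin 6} (ha : a = 4 ∨ a = 5)
    (hi : i ≠ a) (hj : j ≠ a) : x a ∉ segment ℝ (x i) (x j) := by
  rintro ⟨p, q, hp, hq, hpq, h⟩
  have hmem : (fun k => (if k = i then p else 0) + if k = j then q else 0)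
      ∈ stdSimplex ℝ (Fin 6) := by
    refine ⟨fun k => ?_, ?_⟩
    · dsimp only
      split_ifs <;> linarith
    · simp [Finset.sum_add_distrib, hpq]
  have := hx.eq_one_of_sum_smul_eq hmem ha (by simp [add_smul, Finset.sum_add_distrib, h])
  simp [hi.symm, hj.symm] at this
  linarith

lemma base_notMem_axis (hx : IsLebedevaOctahedron x) {k : Fin 6} (hk : k < 4) :
    x k ∉ segment ℝ (x 4) (x 5) := by
  intro h
  have h4 : x k ≠ x 4 := hx.injective.ne (by omega)
  have h5 : x k ≠ x 5 := hx.injective.ne (by omega)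
  rw [← insert_endpoints_openSegment] at h
  rcases h with h | h | h
  · exact h4 h
  · exact h5 h
  · exact hx.notMem_segment_of_mem_axis h (i := k) (j := k) (by omega) (by omega)
      (left_mem_segment _ _ _)

end IsLebedevaOctahedron
/-! ### The perturbed distance -/

section lebedevaDist

variable {x : Fin 6 → EuclideanSpace ℝ (Fin 3)} {ε : ℝ}

lemma lebedevaDist_comm (i j : Fin 6) : lebedevaDist x ε i j = lebedevaDist x ε j i := by
  unfold lebedevaDist
  rw [norm_sub_rev (x j)]
  exact if_congr (by tauto) rfl rfl

lemma lebedevaDist_self (i : Fin 6) : lebedevaDist x ε i i = 0 := by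
  have : ¬((i = 4 ∧ i = 5) ∨ (i = 5 ∧ i = 4)) := by omega
  simp [lebedevaDist, this]

lemma lebedevaDist_of_ne {i j : Fin 6} (h45 : ¬(i = 4 ∧ j = 5)) (h54 : ¬(i = 5 ∧ j = 4)) :
    lebedevaDist x ε i j = ‖x i - x j‖ := by
  simp [lebedevaDist, h45, h54]

lemma norm_le_lebedevaDist (hε : 0 ≤ ε) (i j : Fin 6) : ‖x i - x j‖ ≤ lebedevaDist x ε i j := by
  unfold lebedevaDist
  split_ifs <;> linarith

lemma lebedevaDist_le (hε : 0 ≤ ε) (i j : Fin 6) : lebedevaDist x ε i j ≤ ‖x i - x j‖ + ε := by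
  unfold lebedevaDist
  split_ifs <;> linarith

/-- The vertices with the last one moved away from the fifth, by the distance `ε`. -/
noncomputable def shiftedVertex (x : Fin 6 → EuclideanSpace ℝ (Fin 3)) (ε : ℝ) (i : Fin 6) :
    EuclideanSpace ℝ (Fin 3) :=
  if i = 5 then x 5 + (ε / ‖x 5 - x 4‖) • (x 5 - x 4) else x i

lemma shiftedVertex_of_ne {i : Fin 6} (hi : i ≠ 5) : shiftedVertex x ε i = x i := by
  simp [shiftedVertex, hi]

lemma shiftedVertex_zero (i : Fin 6) : shiftedVertex x 0 i = x i := by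
  by_cases hi : i = 5
  · simp [shiftedVertex, hi]
  · exact shiftedVertex_of_ne hi

lemma continuous_shiftedVertex (i : Fin 6) : Continuous fun ε => shiftedVertex x ε i := by
  unfold shiftedVertex
  split_ifs <;> fun_prop

lemma norm_shiftedVertex_sub (h : x 4 ≠ x 5) (hε : 0 ≤ ε) :
    ‖shiftedVertex x ε 4 - shiftedVertex x ε 5‖ = ‖x 4 - x 5‖ + ε := by
  have hpos : 0 < ‖x 5 - x 4‖ := norm_pos_iff.2 (sub_ne_zero.2 h.symm)
  have : shiftedVertex x ε 5 - shiftedVertex x ε 4 = (1 + ε / ‖x 5 - x 4‖) • (x 5 - x 4) := by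
    rw [shiftedVertex_of_ne (i := 4) (by decide)]
    simp only [shiftedVertex, if_true]
    module
  rw [norm_sub_rev, this, norm_smul, Real.norm_of_nonneg (by positivity), norm_sub_rev (x 4)]
  field_simp

lemma eventually_lt_of_forall_pos {ι : Type*} [Finite ι] {p : ι → Prop} {g : ι → ℝ}
    (h : ∀ i, p i → 0 < g i) : ∀ᶠ δ : ℝ in nhdsWithin 0 (Set.Ioi 0), ∀ i, p i → δ < g i := by
  rw [Filter.eventually_all]
  intro i
  by_cases hi : p i
  · filter_upwards [Ioo_mem_nhdsGT (h i hi)] with δ hδ _ using hδ.2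
  · exact Filter.Eventually.of_forall fun _ h => absurd h hi

lemma exists_pos_lt_of_forall_pos {ι : Type*} [Finite ι] {p : ι → Prop} {g : ι → ℝ}
    (h : ∀ i, p i → 0 < g i) : ∃ δ : ℝ, 0 < δ ∧ ∀ i, p i → δ < g i := by
  obtain ⟨δ, hδ, hδ0⟩ := ((eventually_lt_of_forall_pos h).and self_mem_nhdsWithin).exists
  exact ⟨δ, hδ0, hδ⟩

namespace IsLebedevaOctahedron

/-- For small `ε` the perturbed distance satisfies the triangle inequality. -/
lemma eventually_triangle (hx : IsLebedevaOctahedron x) :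
    ∀ᶠ ε : ℝ in nhdsWithin 0 (Set.Ioi 0), ∀ i j k : Fin 6,
      lebedevaDist x ε i k ≤ lebedevaDist x ε i j + lebedevaDist x ε j k := by
  have h := eventually_lt_of_forall_pos (p := fun k : Fin 6 => k < 4)
    (g := fun k => ‖x 4 - x k‖ + ‖x 5 - x k‖ - ‖x 4 - x 5‖) fun k hk => by
      linarith [norm_lt_norm_sub_add_norm_sub (hx.base_notMem_axis hk)]
  filter_upwards [h, self_mem_nhdsWithin] with ε hε hε0 i j k
  have hε0' : 0 ≤ ε := le_of_lt hε0
  have h1 := norm_le_lebedevaDist (x := x) hε0' i j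
  have h2 := norm_le_lebedevaDist (x := x) hε0' j k
  have h3 := norm_sub_le_norm_sub_add_norm_sub (x i) (x j) (x k)
  by_cases hik : (i = 4 ∧ k = 5) ∨ (i = 5 ∧ k = 4)
  · by_cases hj : j < 4
    · have hj' := hε j hj
      have hle := lebedevaDist_le (x := x) hε0' i k
      rcases hik with ⟨rfl, rfl⟩ | ⟨rfl, rfl⟩
      · rw [norm_sub_rev (x 5) (x j)] at hj'
        linarith
      · rw [norm_sub_rev (x 4) (x j), norm_sub_rev (x 4) (x 5)] at hj'
        linarith
    · have : j = i ∨ j = k := by omega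
      rcases this with rfl | rfl <;> simp [lebedevaDist_self]
  · rw [lebedevaDist_of_ne (by tauto) (by tauto)]
    linarith

/-- Radii that dominate the perturbed distance and come from an approximate realisation. -/
def HasRadii (x : Fin 6 → EuclideanSpace ℝ (Fin 3)) (ε : ℝ) (R : Fin 6 → ℝ) : Prop :=
  ∃ (y : Fin 6 → EuclideanSpace ℝ (Fin 3)) (c u : Fin 6 → ℝ),
    (∀ i j, lebedevaDist x ε i j ≤ u i + u j) ∧
    (∀ i j, ‖y i - y j‖ ^ 2 ≤ lebedevaDist x ε i j ^ 2 + c i + c j) ∧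
    ∀ i, u i ^ 2 + c i ≤ ‖y i - ∑ k, R k • y k‖ ^ 2

/-- The unperturbed points serve with `c = 0`: only the pair of apices needs more than the triangle
inequality, and its slack at the barycentre is positive and varies continuously. -/
lemma eventually_hasRadii_of_notMem_axis {R₀ : Fin 6 → ℝ}
    (hR₀ : ∑ k, R₀ k • x k ∉ segment ℝ (x 4) (x 5)) :
    ∀ᶠ w : ℝ × (Fin 6 → ℝ) in nhds (0, R₀), 0 < w.1 → HasRadii x w.1 w.2 := by
  have hcont : Continuous fun w : ℝ × (Fin 6 → ℝ) =>
      ‖x 4 - ∑ k, w.2 k • x k‖ + ‖x 5 - ∑ k, w.2 k • x k‖ - (‖x 4 - x 5‖ + w.1) := by fun_prop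
  have h0 := hcont.tendsto (0, R₀) |>.eventually (lt_mem_nhds (a := 0) (by
    simpa using norm_lt_norm_sub_add_norm_sub hR₀))
  filter_upwards [h0] with w hw hε
  set z := ∑ k, w.2 k • x k
  refine ⟨x, 0, fun i => ‖x i - z‖, fun i j => ?_, fun i j => ?_, fun i => ?_⟩
  · by_cases hij : (i = 4 ∧ j = 5) ∨ (i = 5 ∧ j = 4)
    · refine (lebedevaDist_le hε.le i j).trans ?_
      rcases hij with ⟨rfl, rfl⟩ | ⟨rfl, rfl⟩
      · linarith
      · rw [norm_sub_rev (x 5) (x 4)]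
        linarith
    · dsimp only
      rw [lebedevaDist_of_ne (by tauto) (by tauto), norm_sub_rev (x j) z]
      exact norm_sub_le_norm_sub_add_norm_sub _ _ _
  · have := norm_le_lebedevaDist (x := x) hε.le i j
    simp only [Pi.zero_apply, add_zero]
    gcongr
  · simp [z]

lemma eventually_hasRadii_of_mem_axis (hx : IsLebedevaOctahedron x) {R₀ : Fin 6 → ℝ}
    (hR₀ : ∑ k, R₀ k • x k ∈ openSegment ℝ (x 4) (x 5)) :
    ∀ᶠ w : ℝ × (Fin 6 → ℝ) in nhds (0, R₀), 0 < w.1 → HasRadii x w.1 w.2 := by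
  set z₀ := ∑ k, R₀ k • x k with hz₀
  -- Since `z₀` lies on no edge other than the axis, every other pair has slack more than `2 * δ` at
  -- `z₀`, enough for both radii to lose `δ`.
  obtain ⟨δ, hδ, hlt⟩ := exists_pos_lt_of_forall_pos
    (p := fun a : Fin 6 × Fin 6 => ¬(a.1 = 4 ∧ a.2 = 5) ∧ ¬(a.1 = 5 ∧ a.2 = 4))
    (g := fun a => (‖x a.1 - z₀‖ + ‖x a.2 - z₀‖ - ‖x a.1 - x a.2‖) / 2) fun a ha => by
      linarith [norm_lt_norm_sub_add_norm_sub (hx.notMem_segment_of_mem_axis hR₀ ha.1 ha.2)]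
  have hy : ∀ i, Continuous fun w : ℝ × (Fin 6 → ℝ) => shiftedVertex x w.1 i := fun i =>
    (continuous_shiftedVertex i).comp continuous_fst
  have hz : Continuous fun w : ℝ × (Fin 6 → ℝ) => ∑ k, w.2 k • shiftedVertex x w.1 k := by
    exact continuous_finsetSum _ fun k _ =>
      ((continuous_apply k).comp continuous_snd).smul (hy k)
  have e1 : ∀ i j : Fin 6, ¬(i = 4 ∧ j = 5) → ¬(i = 5 ∧ j = 4) →
      ∀ᶠ w : ℝ × (Fin 6 → ℝ) in nhds (0, R₀), ‖x i - x j‖ + 2 * δ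
        < ‖shiftedVertex x w.1 i - ∑ k, w.2 k • shiftedVertex x w.1 k‖
          + ‖shiftedVertex x w.1 j - ∑ k, w.2 k • shiftedVertex x w.1 k‖ := by
    intro i j h45 h54
    refine ((((hy i).sub hz).norm.add ((hy j).sub hz).norm).tendsto (0, R₀)).eventually
      (lt_mem_nhds ?_)
    simp only [Pi.add_apply, Pi.sub_apply, shiftedVertex_zero, ← hz₀]
    linarith [hlt (i, j) ⟨h45, h54⟩]
  have e2 : ∀ i j : Fin 6, ∀ᶠ w : ℝ × (Fin 6 → ℝ) in nhds (0, R₀),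
      ‖shiftedVertex x w.1 i - shiftedVertex x w.1 j‖ ^ 2 < ‖x i - x j‖ ^ 2 + δ ^ 2 := by
    intro i j
    refine ((((hy i).sub (hy j)).norm.pow 2).tendsto (0, R₀)).eventually (gt_mem_nhds ?_)
    simp only [Pi.sub_apply, Pi.pow_apply, shiftedVertex_zero]
    linarith [pow_pos hδ 2]
  have e1' : ∀ᶠ w : ℝ × (Fin 6 → ℝ) in nhds (0, R₀), ∀ i j : Fin 6,
      ¬(i = 4 ∧ j = 5) → ¬(i = 5 ∧ j = 4) → ‖x i - x j‖ + 2 * δ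
        < ‖shiftedVertex x w.1 i - ∑ k, w.2 k • shiftedVertex x w.1 k‖
          + ‖shiftedVertex x w.1 j - ∑ k, w.2 k • shiftedVertex x w.1 k‖ := by
    simp only [Filter.eventually_all]
    exact e1
  filter_upwards [e1', Filter.eventually_all.2 fun i => Filter.eventually_all.2 (e2 i)]
    with w h1 h2 hε
  set y := shiftedVertex x w.1 with hydef
  set z := ∑ k, w.2 k • y k with hzdef
  have h45 : ‖y 4 - y 5‖ = ‖x 4 - x 5‖ + w.1 :=
    norm_shiftedVertex_sub (hx.injective.ne (by decide)) hε.le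
  have h45' : ‖x 4 - x 5‖ + w.1 ≤ ‖y 4 - z‖ + ‖y 5 - z‖ := by
    rw [← h45, norm_sub_rev (y 5) z]
    exact norm_sub_le_norm_sub_add_norm_sub _ _ _
  -- The apices keep their full radii because their distance is matched exactly. Any other pair of
  -- distinct points includes a base point, whose `δ ^ 2` covers the error in the squared distance.
  refine ⟨y, fun i => if i < 4 then δ ^ 2 else 0,
    fun i => ‖y i - z‖ - if i < 4 then δ else 0, fun i j => ?_, fun i j => ?_, fun i => ?_⟩
  · by_cases hij : (i = 4 ∧ j = 5) ∨ (i = 5 ∧ j = 4)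
    · have := lebedevaDist_le (x := x) hε.le i j
      rcases hij with ⟨rfl, rfl⟩ | ⟨rfl, rfl⟩
      · simp only [lt_irrefl, if_false, show ¬((5 : Fin 6) < 4) by decide]
        linarith
      · rw [norm_sub_rev (x 5) (x 4)] at this
        simp only [lt_irrefl, if_false, show ¬((5 : Fin 6) < 4) by decide]
        linarith
    · rw [lebedevaDist_of_ne (by tauto) (by tauto)]
      have := h1 i j (by tauto) (by tauto)
      dsimp only
      split_ifs <;> linarith
  · have hle := norm_le_lebedevaDist (x := x) hε.le i j
    have hle2 : ‖x i - x j‖ ^ 2 ≤ lebedevaDist x w.1 i j ^ 2 := by gcongr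
    have := h2 i j
    have hδ2 := pow_pos hδ 2
    by_cases hi : i < 4
    · simp only [hi, if_true]
      split_ifs <;> linarith
    by_cases hj : j < 4
    · simp only [hj, if_true]
      simp only [hi, if_false]
      linarith
    simp only [hi, hj, if_false, add_zero]
    by_cases hij : i = j
    · subst hij
      simp [lebedevaDist_self]
    have h' : (i = 4 ∧ j = 5) ∨ (i = 5 ∧ j = 4) := by omega
    rcases h' with ⟨rfl, rfl⟩ | ⟨rfl, rfl⟩
    · rw [h45]
      simp [lebedevaDist]
    · rw [norm_sub_rev, h45, norm_sub_rev]
      simp [lebedevaDist]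
  · dsimp only
    split_ifs with hi
    -- The diagonal case gives `δ < ‖y i - z‖`, which makes `(‖y i - z‖ - δ) ^ 2 + δ ^ 2 ≤ ‖y i - z‖
    -- ^ 2`.
    · have := h1 i i (by omega) (by omega)
      simp only [sub_self, norm_zero, zero_add] at this
      nlinarith
    · simp [hzdef]

/-- The bounds on `R 4` and `R 5` keep the barycentre away from the apices, which are extreme
points. The two local results then cover a compact set of weights. -/
lemma eventually_forall_hasRadii (hx : IsLebedevaOctahedron x) {η : ℝ} (hη : 0 < η) :
    ∀ᶠ ε : ℝ in nhdsWithin 0 (Set.Ioi 0), ∀ R ∈ stdSimplex ℝ (Fin 6), R 4 ≤ 1 - η → R 5 ≤ 1 - η →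
      HasRadii x ε R := by
  have hK : IsCompact (stdSimplex ℝ (Fin 6) ∩ {R | R 4 ≤ 1 - η ∧ R 5 ≤ 1 - η}) := by
    refine (isCompact_stdSimplex ℝ (Fin 6)).inter_right ?_
    exact (isClosed_le (continuous_apply 4) continuous_const).inter
      (isClosed_le (continuous_apply 5) continuous_const)
  have h := hK.eventually_forall_of_forall_eventually (x₀ := (0 : ℝ))
    (P := fun ε R => 0 < ε → HasRadii x ε R) fun R₀ ⟨hR, h4, h5⟩ => by
      by_cases hz : ∑ k, R₀ k • x k ∈ segment ℝ (x 4) (x 5)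
      · rw [← insert_endpoints_openSegment] at hz
        rcases hz with hz | hz | hz
        · linarith [hx.eq_one_of_sum_smul_eq hR (Or.inl rfl) hz]
        · linarith [hx.eq_one_of_sum_smul_eq hR (Or.inr rfl) hz]
        · exact hx.eventually_hasRadii_of_mem_axis hz
      · exact eventually_hasRadii_of_notMem_axis hz
  filter_upwards [h.filter_mono nhdsWithin_le_nhds, self_mem_nhdsWithin] with ε hε hε0 R hR h4 h5
  exact hε R ⟨hR, h4, h5⟩ hε0

/-- An apex lies on no segment between other vertices, so the triangle inequality through it has
slack bounded below, while the weighted distance to it tends to zero as the weights concentrate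
there. -/
lemma exists_star_bound (hx : IsLebedevaOctahedron x) :
    ∃ η : ℝ, 0 < η ∧ ∀ ε : ℝ, 0 < ε → ε ≤ 1 → ∀ P ∈ stdSimplex ℝ (Fin 6),
      ∀ Q ∈ stdSimplex ℝ (Fin 6), ∀ a : Fin 6, a = 4 ∨ a = 5 → 1 - η ≤ P a → 1 - η ≤ Q a →
      ∀ i j, i ≠ a → j ≠ a → ∑ k, (P k + Q k) * lebedevaDist x ε a k
        ≤ lebedevaDist x ε a i + lebedevaDist x ε a j - lebedevaDist x ε i j := by
  obtain ⟨m, hm, hlt⟩ := exists_pos_lt_of_forall_pos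
    (p := fun b : Fin 6 × Fin 6 × Fin 6 => (b.1 = 4 ∨ b.1 = 5) ∧ b.2.1 ≠ b.1 ∧ b.2.2 ≠ b.1)
    (g := fun b => ‖x b.2.1 - x b.1‖ + ‖x b.2.2 - x b.1‖ - ‖x b.2.1 - x b.2.2‖) fun b hb => by
      linarith [norm_lt_norm_sub_add_norm_sub (hx.apex_notMem_segment hb.1 hb.2.1 hb.2.2)]
  -- `M` bounds all perturbed distances when `ε ≤ 1`. The mass of `P + Q` outside `a` is at most `2
  -- * η`, so `η = m / (2 * M)` bounds the sum by the slack `m`.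
  set M := ∑ i, ∑ j, ‖x i - x j‖ + 1 with hM
  have hM0 : 0 < M := by positivity
  refine ⟨m / (2 * M), by positivity, fun ε hε hε1 P hP Q hQ a ha hPa hQa i j hi hj => ?_⟩
  have hD : ∀ k, lebedevaDist x ε a k ≤ M := fun k => by
    have h1 := lebedevaDist_le (x := x) hε.le a k
    have h2 : ‖x a - x k‖ ≤ ∑ j, ‖x a - x j‖ :=
      Finset.single_le_sum (f := fun j => ‖x a - x j‖) (fun _ _ => norm_nonneg _)
        (Finset.mem_univ k)
    have h3 : ∑ j, ‖x a - x j‖ ≤ ∑ i, ∑ j, ‖x i - x j‖ :=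
      Finset.single_le_sum (f := fun i => ∑ j, ‖x i - x j‖)
        (fun _ _ => Finset.sum_nonneg fun _ _ => norm_nonneg _) (Finset.mem_univ a)
    linarith
  have hsum : ∑ k, (P k + Q k) * lebedevaDist x ε a k ≤ m := by
    calc ∑ k, (P k + Q k) * lebedevaDist x ε a k
        ≤ ∑ k, ((P k + Q k) * M - if k = a then (P k + Q k) * M else 0) := by
          refine Finset.sum_le_sum fun k _ => ?_
          have := mul_le_mul_of_nonneg_left (hD k) (add_nonneg (hP.1 k) (hQ.1 k))
          split_ifs with hk
          · subst hk
            simp [lebedevaDist_self]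
          · linarith
      _ = (2 - (P a + Q a)) * M := by
          rw [Finset.sum_sub_distrib, ← Finset.sum_mul, Finset.sum_add_distrib, hP.2, hQ.2]
          simp
          ring
      _ ≤ (2 * (m / (2 * M))) * M := by
          gcongr
          linarith
      _ = m := by field_simp
  have h1 := hlt (a, i, j) ⟨ha, hi, hj⟩
  have h2 := norm_le_lebedevaDist (x := x) hε.le a i
  have h3 := norm_le_lebedevaDist (x := x) hε.le a j
  have h4 : lebedevaDist x ε i j = ‖x i - x j‖ := lebedevaDist_of_ne (by omega) (by omega)
  rw [norm_sub_rev (x a)] at h2 h3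
  dsimp only at h1
  linarith

/-- For small `ε` all weights admit radii for the perturbed distance. -/
lemma eventually_exists_radii (hx : IsLebedevaOctahedron x) :
    ∀ᶠ ε : ℝ in nhdsWithin 0 (Set.Ioi 0),
      ∀ P ∈ stdSimplex ℝ (Fin 6), ∀ Q ∈ stdSimplex ℝ (Fin 6), ∃ u : Fin 6 → ℝ,
        (∀ i j, lebedevaDist x ε i j ≤ u i + u j) ∧
        ∑ i, (P i + Q i) * u i ^ 2 ≤ ∑ i, ∑ j, P i * Q j * lebedevaDist x ε i j ^ 2 := by
  obtain ⟨η, hη, hstar⟩ := hx.exists_star_bound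
  filter_upwards [hx.eventually_triangle, hx.eventually_forall_hasRadii (half_pos hη),
    Ioc_mem_nhdsGT (zero_lt_one (α := ℝ))] with ε htri hrad hε P hP Q hQ
  have hle1 : ∀ {S : Fin 6 → ℝ}, S ∈ stdSimplex ℝ (Fin 6) → ∀ a, S a ≤ 1 := fun {S} hS a => by
    rw [← hS.2]
    exact Finset.single_le_sum (fun i _ => hS.1 i) (Finset.mem_univ a)
  by_cases hcase : ∃ a : Fin 6, (a = 4 ∨ a = 5) ∧ 1 - η ≤ P a ∧ 1 - η ≤ Q a
  · obtain ⟨a, ha, hPa, hQa⟩ := hcase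
    exact exists_radii_of_star lebedevaDist_comm lebedevaDist_self htri hP hQ a
      (hstar ε hε.1 hε.2 P hP Q hQ a ha hPa hQa)
  · push Not at hcase
    -- If one of the two weights at `a` is below `1 - η`, their mean is at most `1 - η / 2`.
    have hR : ∀ a : Fin 6, a = 4 ∨ a = 5 → (P a + Q a) / 2 ≤ 1 - η / 2 := fun a ha => by
      rcases le_or_gt (1 - η) (P a) with h | h
      · linarith [hcase a ha h, hle1 hP a]
      · linarith [hle1 hQ a]
    obtain ⟨y, c, u, hu, hy, hc⟩ := hrad (fun i => (P i + Q i) / 2)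
      ⟨fun i => by have := hP.1 i; have := hQ.1 i; positivity, by
        rw [← Finset.sum_div, Finset.sum_add_distrib, hP.2, hQ.2]
        norm_num⟩ (hR 4 (Or.inl rfl)) (hR 5 (Or.inr rfl))
    exact ⟨u, hu, sum_radii_sq_le_of_approx hP hQ (fun _ => rfl) hy hc⟩

end IsLebedevaOctahedron

end lebedevaDist
/-! ### Non-embeddability -/

section CAT0

variable {Y : Type u} [MetricSpace Y] {E : Type*} [NormedAddCommGroup E] [InnerProductSpace ℝ E]

lemma norm_sub_add_norm_sub_of_combo {a b c : E} {t : ℝ} (ht : t ∈ Set.Icc (0 : ℝ) 1)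
    (hc : c = (1 - t) • a + t • b) : ‖a - c‖ + ‖c - b‖ = ‖a - b‖ := by
  simp only [← dist_eq_norm]
  refine dist_add_dist_of_mem_segment ?_
  rw [segment_eq_image]
  exact ⟨t, ht, hc.symm⟩

/-- Comparison of a point on a geodesic with the corresponding point of a Euclidean segment. -/
lemma IsCAT0.exists_combo (hY : IsCAT0 Y) {P Q : Y} {a b c : E} {t : ℝ}
    (ht : t ∈ Set.Icc (0 : ℝ) 1) (hc : c = (1 - t) • a + t • b) (hPQ : ‖a - b‖ ≤ dist P Q) :
    ∃ z : Y, ∀ (w : Y) (v : E), dist w Q ≤ ‖v - b‖ →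
      dist w z ^ 2 ≤ ‖v - c‖ ^ 2 + (1 - t) * (dist w P ^ 2 - ‖v - a‖ ^ 2) := by
  obtain ⟨z, hz⟩ := hY.2 P Q t ht
  refine ⟨z, fun w v hQ => (hz w).trans ?_⟩
  rw [hc, norm_sub_combo_sq]
  have h1 : t * dist w Q ^ 2 ≤ t * ‖v - b‖ ^ 2 := by
    have := ht.1
    gcongr
  have h2 : t * (1 - t) * ‖a - b‖ ^ 2 ≤ t * (1 - t) * dist P Q ^ 2 := by
    have := mul_nonneg ht.1 (sub_nonneg.2 ht.2)
    gcongr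
  linarith

lemma IsCAT0.exists_combo' (hY : IsCAT0 Y) {P Q : Y} {a b c : E} {t : ℝ}
    (ht : t ∈ Set.Icc (0 : ℝ) 1) (hc : c = (1 - t) • a + t • b) (hPQ : ‖a - b‖ ≤ dist P Q) :
    ∃ z : Y, ∀ (w : Y) (v : E), dist w P ≤ ‖v - a‖ → dist w Q ≤ ‖v - b‖ →
      dist w z ≤ ‖v - c‖ := by
  obtain ⟨z, hz⟩ := hY.exists_combo ht hc hPQ
  refine ⟨z, fun w v hP hQ => ?_⟩
  have h1 : dist w P ^ 2 ≤ ‖v - a‖ ^ 2 := by gcongr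
  have h2 : (1 - t) * (dist w P ^ 2 - ‖v - a‖ ^ 2) ≤ 0 :=
    mul_nonpos_of_nonneg_of_nonpos (by linarith [ht.2]) (by linarith)
  exact (sq_le_sq₀ dist_nonneg (norm_nonneg _)).1 (by linarith [hz w v hQ])

/-- If a segment of `E` meets the triangle `m, x i, x j` of a quadrilateral with diagonals
`[x i, x i']` and `[x j, x j']`, then its length bounds the distance of the corresponding points
in a `CAT(0)` space. -/
lemma IsCAT0.dist_le_of_quadrilateral (hY : IsCAT0 Y) {xi xi' xj xj' v w m o : E}
    {yi yi' yj yj' V W : Y} {s t A B σ : ℝ} (hs : s ∈ Set.Ioo (0 : ℝ) 1)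
    (ht : t ∈ Set.Ioo (0 : ℝ) 1) (hσ : σ ∈ Set.Ioo (0 : ℝ) 1) (hA : 0 < A) (hB : 0 < B)
    (hAB : A + B < 1) (hms : m = (1 - s) • xi + s • xi') (hmt : m = (1 - t) • xj + t • xj')
    (ho : o = m + A • (xi - m) + B • (xj - m)) (hoσ : o = (1 - σ) • v + σ • w)
    (hii' : ‖xi - xi'‖ ≤ dist yi yi') (hjj' : ‖xj - xj'‖ = dist yj yj')
    (hij' : dist yi yj' ≤ ‖xi - xj'‖)
    (hi'j : dist yi' yj ≤ ‖xi' - xj‖) (hi'j' : dist yi' yj' ≤ ‖xi' - xj'‖)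
    (hVi : dist V yi ≤ ‖v - xi‖) (hVj : dist V yj ≤ ‖v - xj‖) (hVj' : dist V yj' ≤ ‖v - xj'‖)
    (hWi : dist W yi ≤ ‖w - xi‖) (hWj : dist W yj ≤ ‖w - xj‖) (hWj' : dist W yj' ≤ ‖w - xj'‖) :
    dist V W ≤ ‖v - w‖ := by
  have hs0 := hs.1
  have hs1 := hs.2
  have ht0 := ht.1
  have ht1 : 0 < 1 - t := sub_pos.2 ht.2
  have hA1 : 0 < 1 - A := by linarith
  -- The ray from `xi` through `o` meets `[m, xj]` in `a = m + r • (xj - m)`.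
  set r := B / (1 - A) with hr
  have hr0 : 0 < r := by positivity
  have hr1 : r < 1 := by
    rw [hr, div_lt_one hA1]
    linarith
  have hrA : (1 - A) * r = B := by
    rw [hr]
    field_simp
  set a := (1 - t * (1 - r)) • xj + (t * (1 - r)) • xj' with ha
  have htr : t * (1 - r) ∈ Set.Icc (0 : ℝ) 1 :=
    ⟨mul_nonneg ht0.le (by linarith), by nlinarith⟩
  have ham : a = m + r • (xj - m) := by
    rw [ha, hmt]
    module
  set q := 1 - t + t * r with hq
  have hq0 : 0 < q := by positivity
  set β := t * r / q with hβ
  have hβ0 : 0 ≤ β := by positivity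
  have hβ1 : 0 < 1 - β := by
    rw [hβ, sub_pos, div_lt_one hq0]
    linarith
  have hβq : (1 - β) * q = 1 - t := by
    rw [hβ]
    field_simp
    rw [hq]
    ring
  have hmβ : m = (1 - β) • a + β • xj' := by
    have e1 : (1 - β) * (1 - t * (1 - r)) = 1 - t := by
      rw [← hβq, hq]
      ring
    have e2 : (1 - β) * (t * (1 - r)) + β = t := by linarith
    rw [ha, hmt, smul_add, smul_smul, smul_smul, e1, add_assoc, ← add_smul, e2]
  have hoa : o = (1 - (1 - A)) • xi + (1 - A) • a := by
    rw [ho, ham, ← hrA]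
    module
  obtain ⟨a', ha'⟩ := hY.exists_combo' htr ha hjj'.le
  have h1 : ‖a - xj'‖ ≤ dist a' yj' := by
    have e1 := ha' yj xj (by simp) hjj'.symm.le
    have e2 := norm_sub_add_norm_sub_of_combo htr ha
    have e3 := dist_triangle yj a' yj'
    linarith
  obtain ⟨m', hm'⟩ := hY.exists_combo ⟨hβ0, by linarith⟩ hmβ h1
  -- The point `m'` is no farther from `yi'` than in the plane. As the diagonal `yi yi'` is not
  -- shorter, `m'` is no closer to `yi`, and comparison read backwards then bounds `dist yi a'` from
  -- below. This lower bound is what the comparison on `[xi, a]` requires.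
  have h2 : dist yi' m' ≤ ‖xi' - m‖ := by
    refine (sq_le_sq₀ dist_nonneg (norm_nonneg _)).1 ((hm' yi' xi' hi'j').trans ?_)
    have e1 : dist yi' a' ^ 2 ≤ ‖xi' - a‖ ^ 2 := by
      have := ha' yi' xi' hi'j hi'j'
      gcongr
    have := mul_nonpos_of_nonneg_of_nonpos hβ1.le (sub_nonpos.2 e1)
    linarith
  have h3 : ‖xi - m‖ ≤ dist yi m' := by
    have e2 := norm_sub_add_norm_sub_of_combo ⟨hs0.le, hs1.le⟩ hms
    have e3 := dist_triangle yi m' yi'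
    rw [norm_sub_rev m, ← dist_comm yi'] at *
    linarith [dist_comm yi' m']
  have h4 : ‖xi - a‖ ≤ dist yi a' := by
    refine (sq_le_sq₀ (norm_nonneg _) dist_nonneg).1 ?_
    have e1 := hm' yi xi hij'
    have e2 : ‖xi - m‖ ^ 2 ≤ dist yi m' ^ 2 := by gcongr
    have e3 : 0 ≤ (1 - β) * (dist yi a' ^ 2 - ‖xi - a‖ ^ 2) := by linarith
    linarith [nonneg_of_mul_nonneg_right e3 hβ1]
  obtain ⟨o', ho'⟩ := hY.exists_combo' ⟨hA1.le, by linarith⟩ hoa h4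
  have h5 := ho' V v hVi (ha' V v hVj hVj')
  have h6 := ho' W w hWi (ha' W w hWj hWj')
  have h7 := norm_sub_add_norm_sub_of_combo ⟨hσ.1.le, hσ.2.le⟩ hoσ
  have h8 := dist_triangle V o' W
  rw [norm_sub_rev o] at h7
  rw [dist_comm o'] at h8
  linarith

end CAT0

lemma IsLebedevaOctahedron.not_embedsInCAT0 {x : Fin 6 → EuclideanSpace ℝ (Fin 3)}
    (hx : IsLebedevaOctahedron x) {ε : ℝ} (hε : 0 < ε) {X : Type} [MetricSpace X] (e : Fin 6 → X)
    (he : ∀ i j, dist (e i) (e j) = lebedevaDist x ε i j) : ¬ EmbedsInCAT0.{u} X := by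
  rintro ⟨Y, _, hY, F, hF⟩
  obtain ⟨i, i', j, j', hi, hi', hj, hj', -, s, t, A, B, σ, hs, ht, hσ, hA, hB, hAB, m, o, hms, hmt,
    ho, hoσ, -⟩ := hx.exists_crossing
  have hd : ∀ k l : Fin 6, l < 4 → dist (F (e k)) (F (e l)) = ‖x k - x l‖ := fun k l hl => by
    rw [hF.dist_eq, he, lebedevaDist_of_ne (by omega) (by omega)]
  have h := hY.dist_le_of_quadrilateral hs ht hσ hA hB hAB hms hmt ho hoσ (hd i i' hi').ge
    (hd j j' hj').symm (hd i j' hj').le (hd i' j hj).le (hd i' j' hj').le (hd 4 i hi).le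
    (hd 4 j hj).le (hd 4 j' hj').le (hd 5 i hi).le (hd 5 j hj).le (hd 5 j' hj').le
  rw [hF.dist_eq, he] at h
  simp only [lebedevaDist, and_self, true_or, if_true] at h
  linarith

/-! ### The metric spaces -/

/-- The metric space given by a distance matrix. -/
@[reducible]
noncomputable def metricSpaceOfMatrix {ι : Type} (D : ι → ι → ℝ) (hself : ∀ i, D i i = 0)
    (hsymm : ∀ i j, D i j = D j i) (htri : ∀ i j k, D i k ≤ D i j + D j k)
    (hpos : ∀ i j, i ≠ j → 0 < D i j) : MetricSpace ι where
  dist := D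
  dist_self := hself
  dist_comm := hsymm
  dist_triangle := htri
  eq_of_dist_eq_zero := fun {i j} h => by
    by_contra hij
    exact (hpos i j hij).ne' h

theorem IsLebedevaOctahedron.exists_metricSpace {x : Fin 6 → EuclideanSpace ℝ (Fin 3)}
    (hx : IsLebedevaOctahedron x) :
    ∃ C : ℝ, 0 < C ∧ ∀ ε : ℝ, 0 < ε → ε ≤ C →
      ∃ (X : Type) (_ : MetricSpace X) (e : Fin 6 ≃ X),
        (∀ i j, dist (e i) (e j) = lebedevaDist x ε i j) ∧
        (∀ n : ℕ, 0 < n → SatisfiesANN X n) ∧ ¬ EmbedsInCAT0.{u} X := by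
  obtain ⟨C, hC, h⟩ := mem_nhdsGT_iff_exists_Ioc_subset.1
    (hx.eventually_triangle.and hx.eventually_exists_radii)
  refine ⟨C, hC, fun ε hε hεC => ?_⟩
  obtain ⟨htri, hrad⟩ := h ⟨hε, hεC⟩
  have hpos : ∀ i j, i ≠ j → 0 < lebedevaDist x ε i j := fun i j hij =>
    (norm_pos_iff.2 (sub_ne_zero.2 (hx.injective.ne hij))).trans_le
      (norm_le_lebedevaDist hε.le i j)
  let inst : MetricSpace (Fin 6) := metricSpaceOfMatrix (lebedevaDist x ε) lebedevaDist_self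
    lebedevaDist_comm htri hpos
  exact ⟨Fin 6, inst, Equiv.refl _, fun _ _ => rfl,
    fun n _ => satisfiesANN_of_radii (Equiv.refl _) hrad n,
    hx.not_embedsInCAT0 hε (Equiv.refl _) fun _ _ => rfl⟩

/-! ### An example -/

/-- A square with an axis through one of the four triangles cut out by its diagonals. -/
noncomputable def squareOctahedron : Fin 6 → EuclideanSpace ℝ (Fin 3) :=
  ![!₂[1, 0, 0], !₂[0, 1, 0], !₂[-1, 0, 0], !₂[0, -1, 0], !₂[1 / 4, 1 / 4, 1],
    !₂[1 / 4, 1 / 4, -1]]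

lemma isLebedevaOctahedron_squareOctahedron : IsLebedevaOctahedron squareOctahedron where
  injective := by
    intro i j h
    have h0 := congrArg (fun v : EuclideanSpace ℝ (Fin 3) => v 0) h
    have h1 := congrArg (fun v : EuclideanSpace ℝ (Fin 3) => v 1) h
    have h2 := congrArg (fun v : EuclideanSpace ℝ (Fin 3) => v 2) h
    fin_cases i <;> fin_cases j <;> simp [squareOctahedron] at h0 h1 h2 ⊢ <;>
      linarith
  diagonals := by
    rw [Set.ncard_eq_one]
    refine ⟨0, Set.eq_singleton_iff_unique_mem.2 ⟨⟨?_, ?_⟩, ?_⟩⟩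
    · refine ⟨1 / 2, 1 / 2, by norm_num, by norm_num, by norm_num, ?_⟩
      ext k
      fin_cases k <;> simp [squareOctahedron]
    · refine ⟨1 / 2, 1 / 2, by norm_num, by norm_num, by norm_num, ?_⟩
      ext k
      fin_cases k <;> simp [squareOctahedron]
    · rintro y ⟨⟨a, b, -, -, hab, rfl⟩, ⟨c, d, -, -, hcd, h⟩⟩
      have h0 := congrArg (fun v : EuclideanSpace ℝ (Fin 3) => v 0) h
      simp [squareOctahedron] at h0
      ext k
      fin_cases k <;> simp [squareOctahedron]
      linarith
  axis := by
    rw [Set.ncard_eq_one]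
    refine ⟨!₂[1 / 4, 1 / 4, 0], Set.eq_singleton_iff_unique_mem.2 ⟨⟨?_, ?_, ?_⟩, ?_⟩⟩
    · refine ⟨1 / 2, 1 / 2, by norm_num, by norm_num, by norm_num, ?_⟩
      ext k
      fin_cases k <;> simp [squareOctahedron] <;> norm_num
    · have hc := convex_convexHull ℝ ({squareOctahedron 0, squareOctahedron 1, squareOctahedron 2,
        squareOctahedron 3} : Set (EuclideanSpace ℝ (Fin 3)))
      have h := subset_convexHull ℝ ({squareOctahedron 0, squareOctahedron 1, squareOctahedron 2,
        squareOctahedron 3} : Set (EuclideanSpace ℝ (Fin 3)))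
      have h01 := hc (h (by simp : squareOctahedron 0 ∈ _)) (h (by simp : squareOctahedron 1 ∈ _))
        (by norm_num : (0 : ℝ) ≤ 1 / 2) (by norm_num : (0 : ℝ) ≤ 1 / 2) (by norm_num)
      have h02 := hc (h (by simp : squareOctahedron 0 ∈ _)) (h (by simp : squareOctahedron 2 ∈ _))
        (by norm_num : (0 : ℝ) ≤ 1 / 2) (by norm_num : (0 : ℝ) ≤ 1 / 2) (by norm_num)
      convert hc h01 h02 (by norm_num : (0 : ℝ) ≤ 1 / 2) (by norm_num : (0 : ℝ) ≤ 1 / 2)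
        (by norm_num) using 1
      ext k
      fin_cases k <;> simp [squareOctahedron] <;> norm_num
    · rintro ⟨i, j, hij, hj, a, b, ha, hb, hab, h⟩
      have h0 := congrArg (fun v : EuclideanSpace ℝ (Fin 3) => v 0) h
      have h1 := congrArg (fun v : EuclideanSpace ℝ (Fin 3) => v 1) h
      fin_cases i <;> fin_cases j <;> simp [squareOctahedron] at hij hj h0 h1 <;> linarith
    · rintro y ⟨⟨a, b, -, -, hab, rfl⟩, hy, -⟩
      have hplane : convexHull ℝ ({squareOctahedron 0, squareOctahedron 1, squareOctahedron 2,
          squareOctahedron 3} : Set (EuclideanSpace ℝ (Fin 3))) ⊆ {v | v 2 = 0} := by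
        refine convexHull_min ?_ ?_
        · rintro v (rfl | rfl | rfl | rfl) <;> simp [squareOctahedron]
        · intro v hv w hw p q _ _ _
          have hv' : v 2 = 0 := hv
          have hw' : w 2 = 0 := hw
          simp [hv', hw']
      have h2 := hplane hy
      simp [squareOctahedron] at h2
      ext k
      fin_cases k <;> simp [squareOctahedron] <;> linarith

theorem mainTheorem1 :
    (∃ (X : Type) (_ : MetricSpace X), Nat.card X = 6 ∧
      (∀ n : ℕ, 0 < n → SatisfiesANN X n) ∧ ¬ EmbedsInCAT0.{u} X) ∧
    (∃ x : Fin 6 → EuclideanSpace ℝ (Fin 3), IsLebedevaOctahedron x) ∧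
    (∀ x : Fin 6 → EuclideanSpace ℝ (Fin 3), IsLebedevaOctahedron x →
      ∃ C : ℝ, 0 < C ∧ ∀ ε : ℝ, 0 < ε → ε ≤ C →
        ∃ (X : Type) (_ : MetricSpace X) (e : Fin 6 ≃ X),
          (∀ i j, dist (e i) (e j) = lebedevaDist x ε i j) ∧
          (∀ n : ℕ, 0 < n → SatisfiesANN X n) ∧ ¬ EmbedsInCAT0.{u} X) := by
  refine ⟨?_, ⟨_, isLebedevaOctahedron_squareOctahedron⟩, fun x hx => hx.exists_metricSpace⟩
  obtain ⟨C, hC, h⟩ := isLebedevaOctahedron_squareOctahedron.exists_metricSpace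
  obtain ⟨X, inst, e, -, hANN, hCAT⟩ := h C hC le_rfl
  exact ⟨X, inst, by rw [← Nat.card_congr e, Nat.card_fin], hANN, hCAT⟩
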